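/- A function $f:\mathbb{R}^d\to\mathbb{R}$ is called DC if it is the difference of two convex functions $\mathbb{R}^d\to\mathbb{R}$. For a nonempty set $A\subset\mathbb{R}^d$ let $d_A(x)=\inf_{a\in A}|x-a|$, where $|\cdot|$ is the Euclidean norm, and let $$\mathcal{D}_d=\{\varnothing\}\cup\{A\subset\mathbb{R}^d:\ A\neq\varnothing,\ A\text{ is closed and } d_A \text{ is DC}\}.$$ There are sets $A,B\in\mathcal{D}_2$ such that $A\cap B\notin\mathcal{D}_2$. Further, there is a set $K\in\mathcal{D}_2$ such that $\partial K\notin\mathcal{D}_2$ and $\overline{\mathbb{R}^2\setminus K}\notin\mathcal{D}_2$. -/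

import Mathlib

/-- `f` is a DC function on the convex set `C`: on `C` it is the difference of two
real-valued convex functions. -/
def IsDCOn {E : Type*} [AddCommGroup E] [Module ℝ E] (C : Set E) (f : E → ℝ) : Prop :=
  ∃ g h : E → ℝ, ConvexOn ℝ C g ∧ ConvexOn ℝ C h ∧ ∀ x ∈ C, f x = g x - h x

/-- The system of subsets of `ℝᵈ` (Euclidean norm) with DC distance function: the empty set,
together with all nonempty closed sets `A` such that `dist(·, A)` is DC on `ℝᵈ`. -/
def DCDistSets (d : ℕ) : Set (Set (EuclideanSpace ℝ (Fin d))) :=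
  {∅} ∪ {A | A.Nonempty ∧ IsClosed A ∧ IsDCOn Set.univ (fun x => Metric.infDist x A)}

open Set Metric Filter Topology

/-! ### Distance functions of unions, convex sets and complements of convex sets -/

section DistanceFunctions

/-! Take `x n` strictly decreasing to `0`, let `A` be the region on or below the parabola, and let
`B` be the convex set above the secants over `[x (2n+1), x (2n)]`. The distance to `B` is convex;
the distance to `A` is DC since `Aᶜ` is convex; and `K = A ∪ B` has the minimum of the two as its
distance.

Between its ends a secant lies above the parabola, so `A ∩ B` keeps the parabola points over all `x
n` but misses the strips over `(x (2n+1), x (2n))`. Likewise `closure Kᶜ` and `frontier K` contain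
these points but miss the strips over `(x (2n+2), x (2n+1))`. Along the parabola such a distance has
infinitely many tents of slope about one accumulating at `0`. A DC function stays DC along the
parabola near `0`, and each tent costs the subtracted convex function a slope jump of at least `2`,
so its slopes would be unbounded near an interior point. -/

theorem infDist_union_eq_min {α : Type*} [PseudoMetricSpace α] {A B : Set α}
    (hA : A.Nonempty) (hB : B.Nonempty) (x : α) :
    infDist x (A ∪ B) = min (infDist x A) (infDist x B) := by
  simp only [infDist, infEDist_union]
  exact ENNReal.toReal_min (infEDist_ne_top hA) (infEDist_ne_top hB)

variable {E : Type*} [NormedAddCommGroup E] [NormedSpace ℝ E]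

theorem IsDCOn.min {C : Set E} {f₁ f₂ : E → ℝ} (h₁ : IsDCOn C f₁) (h₂ : IsDCOn C f₂) :
    IsDCOn C (fun x => min (f₁ x) (f₂ x)) := by
  obtain ⟨g, h, hg, hh, e⟩ := h₁
  obtain ⟨g', h', hg', hh', e'⟩ := h₂
  refine ⟨g + g', (h + g') ⊔ (h' + g), hg.add hg', (hh.add hg').sup (hh'.add hg), fun x hx => ?_⟩
  simp only [e x hx, e' x hx, Pi.add_apply, Pi.sup_apply]
  rcases le_total (h x + g' x) (h' x + g x) with H | H
  · rw [sup_eq_right.2 H, min_eq_right (by linarith)]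
    ring
  · rw [sup_eq_left.2 H, min_eq_left (by linarith)]
    ring

theorem Convex.convexOn_univ_infDist {B : Set E} (hB : Convex ℝ B) (hne : B.Nonempty) :
    ConvexOn ℝ univ (fun x => infDist x B) := by
  refine ⟨convex_univ, fun x _ y _ a b ha hb hab => ?_⟩
  refine le_of_forall_pos_le_add fun ε hε => ?_
  obtain ⟨u, hu, hxu⟩ := (infDist_lt_iff hne).1 (lt_add_of_pos_right (infDist x B) hε)
  obtain ⟨v, hv, hyv⟩ := (infDist_lt_iff hne).1 (lt_add_of_pos_right (infDist y B) hε)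
  have h1 := infDist_le_dist_of_mem (x := a • x + b • y) (hB hu hv ha hb hab)
  have h2 : dist (a • x + b • y) (a • u + b • v) ≤ a * dist x u + b * dist y v := by
    refine (dist_add_add_le _ _ _ _).trans_eq ?_
    rw [dist_smul₀, dist_smul₀, Real.norm_of_nonneg ha, Real.norm_of_nonneg hb]
  simp only [smul_eq_mul]
  have h3 := mul_le_mul_of_nonneg_left hxu.le ha
  have h4 := mul_le_mul_of_nonneg_left hyv.le hb
  have h5 : a * (infDist x B + ε) + b * (infDist y B + ε)
      = a * infDist x B + b * infDist y B + ε := by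
    linear_combination ε * hab
  linarith

theorem Convex.concaveOn_infDist_compl {U : Set E} (hU : Convex ℝ U) (hne : Uᶜ.Nonempty) :
    ConcaveOn ℝ U (fun x => infDist x Uᶜ) := by
  refine ⟨hU, fun x hx y hy a b ha hb hab => ?_⟩
  simp only [smul_eq_mul]
  rw [le_infDist hne]
  intro w hw
  by_contra! hlt
  set r := a * infDist x Uᶜ + b * infDist y Uᶜ with hr
  have hr0 : 0 < r := dist_nonneg.trans_lt hlt
  set v := w - (a • x + b • y) with hv
  have hvr : ‖v‖ < r := by rwa [hv, ← dist_eq_norm, dist_comm]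
  -- If `w ∉ U` were closer than `r`, moving `x` and `y` along `v` in proportion to their distances
  -- to `Uᶜ` keeps them in `U`, yet the combination of the moved points is `w`.
  have key : ∀ z ∈ U, z + (infDist z Uᶜ / r) • v ∈ U := by
    intro z hz
    rcases (infDist_nonneg (x := z) (s := Uᶜ)).eq_or_lt with h0 | h0
    · simpa [← h0] using hz
    · apply ball_infDist_compl_subset (x := z)
      rw [mem_ball, dist_eq_norm, add_sub_cancel_left, norm_smul, Real.norm_of_nonneg (by positivity),
        div_mul_eq_mul_div, div_lt_iff₀ hr0]
      exact mul_lt_mul_of_pos_left hvr h0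
  apply hw
  convert hU (key x hx) (key y hy) ha hb hab using 1
  have : (a * (infDist x Uᶜ / r) + b * (infDist y Uᶜ / r)) = 1 := by
    field_simp
    exact hr.symm
  calc w = a • x + b • y + (1 : ℝ) • v := by rw [one_smul, hv]; abel
    _ = _ := by rw [← this]; module

/-- A concave `1`-Lipschitz function on a convex set has a concave extension, given by the
sup-convolution with the distance. -/
theorem ConcaveOn.iSup_sub_dist {U : Set E} {f : E → ℝ} (hf : ConcaveOn ℝ U f) (hne : U.Nonempty)
    (hbdd : ∀ z : E, BddAbove (range fun u : U => f u - dist z u)) :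
    ConcaveOn ℝ univ (fun z : E => ⨆ u : U, (f u - dist z u)) := by
  have := hne.to_subtype
  refine ⟨convex_univ, fun x _ y _ a b ha hb hab => ?_⟩
  refine le_of_forall_pos_le_add fun ε hε => ?_
  obtain ⟨⟨u, hu⟩, hxu⟩ := exists_lt_of_lt_ciSup (sub_lt_self (⨆ u : U, (f u - dist x u)) hε)
  obtain ⟨⟨v, hv⟩, hyv⟩ := exists_lt_of_lt_ciSup (sub_lt_self (⨆ u : U, (f u - dist y u)) hε)
  have h1 := le_ciSup (hbdd (a • x + b • y)) ⟨a • u + b • v, hf.1 hu hv ha hb hab⟩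
  have h2 : dist (a • x + b • y) (a • u + b • v) ≤ a * dist x u + b * dist y v := by
    refine (dist_add_add_le _ _ _ _).trans_eq ?_
    rw [dist_smul₀, dist_smul₀, Real.norm_of_nonneg ha, Real.norm_of_nonneg hb]
  have h0 := hf.2 hu hv ha hb hab
  simp only [smul_eq_mul] at h0 h1 hxu hyv ⊢
  have h3 := mul_le_mul_of_nonneg_left hxu.le ha
  have h4 := mul_le_mul_of_nonneg_left hyv.le hb
  have h5 : a * ((⨆ u : U, (f u - dist x u)) - ε) + b * ((⨆ u : U, (f u - dist y u)) - ε)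
      = a * (⨆ u : U, (f u - dist x u)) + b * (⨆ u : U, (f u - dist y u)) - ε := by
    linear_combination -ε * hab
  linarith

/-- The distance is `max 0 φ`, where `φ` is a concave extension of it from `U` to the whole space;
off `U` one has `φ ≤ 0`. -/
theorem Convex.isDCOn_infDist_compl {U : Set E} (hU : Convex ℝ U) (hne : U.Nonempty)
    (hne' : Uᶜ.Nonempty) : IsDCOn univ (fun x => infDist x Uᶜ) := by
  have hle : ∀ (z : E) (u : U), infDist (u : E) Uᶜ - dist z u ≤ infDist z Uᶜ := fun z u => by
    have := infDist_le_infDist_add_dist (x := (u : E)) (y := z) (s := Uᶜ)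
    rw [dist_comm] at this
    linarith
  have hbdd : ∀ z : E, BddAbove (range fun u : U => infDist (u : E) Uᶜ - dist z u) := fun z =>
    ⟨infDist z Uᶜ, by rintro _ ⟨u, rfl⟩; exact hle z u⟩
  have hne0 := hne.to_subtype
  have hφ := (hU.concaveOn_infDist_compl hne').iSup_sub_dist hne hbdd
  set φ : E → ℝ := fun z => ⨆ u : U, (infDist (u : E) Uᶜ - dist z u) with hφd
  refine ⟨(fun _ => 0) ⊔ -φ, -φ, (convexOn_const 0 convex_univ).sup hφ.neg, hφ.neg, fun z _ => ?_⟩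
  have hz : φ z ≤ infDist z Uᶜ := ciSup_le (hle z)
  simp only [Pi.sup_apply, Pi.neg_apply]
  by_cases hzU : z ∈ U
  · have h1 : infDist z Uᶜ ≤ φ z := by
      simpa using le_ciSup (hbdd z) ⟨z, hzU⟩
    have h2 := infDist_nonneg (x := z) (s := Uᶜ)
    rw [sup_eq_left.2 (by linarith)]
    linarith
  · have h1 : infDist z Uᶜ = 0 := infDist_zero_of_mem hzU
    rw [sup_eq_right.2 (by linarith), h1]
    ring

end DistanceFunctions

/-! ### Accumulating tents on the line -/

section RealLine

/-- A difference of convex functions near `0` cannot vanish at the ends of intervals `[a k, b k]`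
decreasing to `0` while being at least half their length at their midpoints. -/
theorem not_sub_convexOn_of_tents {δ : ℝ} (hδ : 0 < δ) {φ ψ : ℝ → ℝ}
    (hφ : ConvexOn ℝ (Ioo (-δ) δ) φ) (hψ : ConvexOn ℝ (Ioo (-δ) δ) ψ) {a b : ℕ → ℝ}
    (ha : ∀ k, 0 < a k) (hab : ∀ k, a k < b k) (hba : ∀ k, b (k + 1) ≤ a k)
    (hbδ : ∀ k, b k < δ) (hea : ∀ k, φ (a k) = ψ (a k)) (heb : ∀ k, φ (b k) = ψ (b k))
    (hm : ∀ k, (b k - a k) / 2 ≤ φ ((a k + b k) / 2) - ψ ((a k + b k) / 2)) : False := by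
  have hmem : ∀ x, 0 ≤ x → x < δ → x ∈ Ioo (-δ) δ := fun x h h' => ⟨by linarith, h'⟩
  set m : ℕ → ℝ := fun k => (a k + b k) / 2 with hmd
  have ham : ∀ k, a k < m k := fun k => by have := hab k; simp only [hmd]; linarith
  have hmb : ∀ k, m k < b k := fun k => by have := hab k; simp only [hmd]; linarith
  set t : ℕ → ℝ := fun k => (ψ (b k) - ψ (m k)) / (b k - m k) with ht
  -- Passing from `ψ` to `φ` raises the midpoint by at least `m k - a k` and fixes the ends. As `φ`
  -- has nondecreasing slopes, those of `ψ` must jump by at least `2`.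
  have hjump : ∀ k, (ψ (m k) - ψ (a k)) / (m k - a k) + 2 ≤ t k := by
    intro k
    have h1 := hφ.slope_mono_adjacent (hmem _ (ha k).le ((hab k).trans (hbδ k)))
      (hmem _ ((ha k).trans (hab k)).le (hbδ k)) (ham k) (hmb k)
    have h2 : b k - m k = m k - a k := by simp only [hmd]; ring
    have h3 : 0 < m k - a k := sub_pos.2 (ham k)
    have h4 : m k - a k ≤ φ (m k) - ψ (m k) := by
      refine le_trans (le_of_eq ?_) (hm k)
      simp only [hmd]; ring
    simp only [ht]
    rw [h2] at h1 ⊢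
    rw [div_le_div_iff_of_pos_right h3, hea, heb] at h1
    rw [← sub_nonneg]
    have : (ψ (b k) - ψ (m k)) / (m k - a k) - ((ψ (m k) - ψ (a k)) / (m k - a k) + 2)
        = (ψ (b k) - ψ (m k) - (ψ (m k) - ψ (a k)) - 2 * (m k - a k)) / (m k - a k) := by
      field_simp
      ring
    rw [this]
    apply div_nonneg _ h3.le
    linarith
  have hstep : ∀ k, t (k + 1) ≤ (ψ (m k) - ψ (a k)) / (m k - a k) := by
    intro k
    have hmδ : m k < δ := (hmb k).trans (hbδ k)
    have hm0 : 0 ≤ m k := ((ha k).trans (ham k)).le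
    have hm1 : 0 ≤ m (k + 1) := ((ha _).trans (ham _)).le
    rcases (hba k).eq_or_lt with h | h
    · have := hψ.slope_mono_adjacent (hmem _ hm1 ((hmb _).trans (hbδ _))) (hmem _ hm0 hmδ)
        (hmb (k + 1)) (h ▸ ham k)
      simpa only [ht, h] using this
    · have h1 := hψ.slope_mono_adjacent (hmem _ hm1 ((hmb _).trans (hbδ _)))
        (hmem _ (ha k).le ((hab k).trans (hbδ k))) (hmb (k + 1)) h
      have h2 := hψ.slope_mono_adjacent (hmem _ ((ha _).trans (hab _)).le (hbδ (k + 1)))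
        (hmem _ hm0 hmδ) h (ham k)
      exact h1.trans h2
  have hdecr : ∀ k : ℕ, t k ≤ t 0 - 2 * k := by
    intro k
    induction k with
    | zero => simp
    | succ k ih =>
      have := hstep k
      have := hjump k
      push_cast
      linarith
  -- A slope of `ψ` to the left of `0` bounds all `t k` from below.
  set c := (ψ 0 - ψ (-δ / 2)) / (0 - -δ / 2) with hc
  have hbelow : ∀ k, c ≤ t k := by
    intro k
    have hm0 : 0 < m k := (ha k).trans (ham k)
    have h1 := hψ.slope_mono_adjacent (x := -δ / 2) (y := 0) ⟨by linarith, by linarith⟩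
      (hmem _ hm0.le ((hmb k).trans (hbδ k))) (by linarith) hm0
    have h2 := hψ.slope_mono_adjacent (hmem 0 le_rfl hδ)
      (hmem _ ((ha k).trans (hab k)).le (hbδ k)) hm0 (hmb k)
    exact h1.trans h2
  obtain ⟨n, hn⟩ := exists_nat_gt (t 0 - c)
  have := hbelow n
  have := hdecr n
  have : (0 : ℝ) ≤ n := n.cast_nonneg
  linarith

end RealLine

/-! ### Restriction to the parabola and the planar examples -/

section Parabola

/-- The point of the standard parabola over `x`. -/
noncomputable def parabolaPoint (x : ℝ) : EuclideanSpace ℝ (Fin 2) := !₂[x, x ^ 2]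

@[simp] theorem parabolaPoint_zero (x : ℝ) : parabolaPoint x 0 = x := rfl

@[simp] theorem parabolaPoint_one (x : ℝ) : parabolaPoint x 1 = x ^ 2 := rfl

theorem continuous_parabolaPoint : Continuous parabolaPoint := by
  unfold parabolaPoint
  fun_prop

/-- A convex function of the plane becomes convex along the parabola near its vertex after adding a
multiple of `x ^ 2`. -/
theorem ConvexOn.exists_convexOn_comp_parabolaPoint {h : EuclideanSpace ℝ (Fin 2) → ℝ}
    (hh : ConvexOn ℝ univ h) :
    ∃ M₀ : ℝ, ∃ δ > 0, ∀ M ≥ M₀, ∀ δ' ≤ δ,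
      ConvexOn ℝ (Ioo (-δ') δ') (fun x => h (parabolaPoint x) + M * x ^ 2) := by
  obtain ⟨L, V, hV, hL⟩ := hh.locallyLipschitz (parabolaPoint 0)
  obtain ⟨r, hr, hrV⟩ := Metric.mem_nhds_iff.1 hV
  obtain ⟨δ, hδ, hδr⟩ := Metric.continuousAt_iff.1 continuous_parabolaPoint.continuousAt r hr
  refine ⟨L, δ, hδ, fun M hM δ' hδ' => ⟨convex_Ioo _ _, fun x hx y hy a b ha hb hab => ?_⟩⟩
  have hball : ∀ z ∈ Ioo (-δ') δ', parabolaPoint z ∈ ball (parabolaPoint 0) r := fun z hz => by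
    refine hδr ?_
    rw [Real.dist_eq, sub_zero, abs_lt]
    exact ⟨by linarith [hz.1], by linarith [hz.2]⟩
  have hc := (convex_ball (parabolaPoint 0) r) (hball x hx) (hball y hy) ha hb hab
  have hm := hball _ (convex_Ioo _ _ hx hy ha hb hab)
  have h1 := hL.dist_le_mul _ (hrV hm) _ (hrV hc)
  -- The gap between chord and parabola equals the convexity defect of `x ^ 2`, so a multiple at
  -- least the Lipschitz constant absorbs the error.
  have h2 : dist (parabolaPoint (a • x + b • y)) (a • parabolaPoint x + b • parabolaPoint y)
      = a * b * (x - y) ^ 2 := by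
    rw [EuclideanSpace.dist_eq, Fin.sum_univ_two]
    simp only [parabolaPoint_zero, parabolaPoint_one, PiLp.add_apply, PiLp.smul_apply, smul_eq_mul,
      dist_self, Real.dist_eq, sq_abs]
    have : (a * x + b * y) ^ 2 - (a * x ^ 2 + b * y ^ 2) = -(a * b * (x - y) ^ 2) := by
      obtain rfl : b = 1 - a := by linarith
      ring
    rw [this, zero_pow two_ne_zero, zero_add, neg_sq, Real.sqrt_sq (by positivity)]
  rw [h2, Real.dist_eq] at h1
  have h3 := (abs_le.1 h1).2
  have h4 := hh.2 (mem_univ (parabolaPoint x)) (mem_univ (parabolaPoint y)) ha hb hab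
  simp only [smul_eq_mul] at h3 h4 ⊢
  have h5 : (L : ℝ) * (a * b * (x - y) ^ 2) ≤ M * (a * b * (x - y) ^ 2) :=
    mul_le_mul_of_nonneg_right hM (by positivity)
  have h6 : a * b * (x - y) ^ 2 = a * x ^ 2 + b * y ^ 2 - (a * x + b * y) ^ 2 := by
    obtain rfl : b = 1 - a := by linarith
    ring
  rw [h6] at h3 h5
  linarith

/-- A set which contains the ends of parabola arcs over intervals `[a k, b k]` decreasing to `0`,
and misses the strips between them, does not have a DC distance function. -/
theorem not_mem_DCDistSets_of_strips {S : Set (EuclideanSpace ℝ (Fin 2))} {a b : ℕ → ℝ}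
    (ha : ∀ k, 0 < a k) (hab : ∀ k, a k < b k) (hba : ∀ k, b (k + 1) ≤ a k)
    (hb0 : Tendsto b atTop (𝓝 0)) (haS : ∀ k, parabolaPoint (a k) ∈ S)
    (hbS : ∀ k, parabolaPoint (b k) ∈ S) (hS : ∀ k, ∀ z ∈ S, z 0 ∉ Ioo (a k) (b k)) :
    S ∉ DCDistSets 2 := by
  rintro (h | ⟨hne, -, g, h, hg, hh, e⟩)
  · exact (h ▸ haS 0 : parabolaPoint (a 0) ∈ (∅ : Set (EuclideanSpace ℝ (Fin 2))))
  obtain ⟨M₁, δ₁, hδ₁, H₁⟩ := hg.exists_convexOn_comp_parabolaPoint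
  obtain ⟨M₂, δ₂, hδ₂, H₂⟩ := hh.exists_convexOn_comp_parabolaPoint
  have hδ : 0 < min δ₁ δ₂ := lt_min hδ₁ hδ₂
  obtain ⟨N, hN⟩ := eventually_atTop.1 (hb0.eventually_lt_const hδ)
  have hzero : ∀ x, parabolaPoint x ∈ S → g (parabolaPoint x) = h (parabolaPoint x) := fun x hx => by
    have := e _ (mem_univ (parabolaPoint x))
    simp only [infDist_zero_of_mem hx] at this
    linarith
  -- The same multiple of `x ^ 2` is added to both functions, so it cancels in the difference.
  refine not_sub_convexOn_of_tents hδ (H₁ (max M₁ M₂) (le_max_left _ _) _ (min_le_left _ _))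
    (H₂ (max M₁ M₂) (le_max_right _ _) _ (min_le_right _ _))
    (a := fun k => a (k + N)) (b := fun k => b (k + N)) (fun k => ha _) (fun k => hab _)
    (fun k => by simpa only [add_right_comm] using hba (k + N)) (fun k => hN _ (by omega))
    (fun k => by simp only [hzero _ (haS _)]) (fun k => by simp only [hzero _ (hbS _)])
    (fun k => ?_)
  set m := (a (k + N) + b (k + N)) / 2 with hm
  have h1 : (b (k + N) - a (k + N)) / 2 ≤ infDist (parabolaPoint m) S := by
    rw [le_infDist hne]
    intro z hz
    -- The first coordinate is `1`-Lipschitz, so the distance to `S` is at least half the strip's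
    -- width.
    have h2 : |m - z 0| ≤ dist (parabolaPoint m) z := by
      simpa [dist_eq_norm] using PiLp.norm_apply_le (parabolaPoint m - z) 0
    refine le_trans ?_ h2
    have h3 := hS (k + N) z hz
    rw [mem_Ioo, not_and_or, not_lt, not_lt] at h3
    rcases h3 with h3 | h3
    · exact le_trans (by linarith) (le_abs_self _)
    · exact le_trans (by linarith) (neg_le_abs _)
  have h2 := e _ (mem_univ (parabolaPoint m))
  simp only at h2
  linarith

/-- The region on or below the parabola. -/
def parabolaHypograph : Set (EuclideanSpace ℝ (Fin 2)) := {z | z 1 ≤ z 0 ^ 2}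

theorem parabolaPoint_mem_parabolaHypograph (x : ℝ) : parabolaPoint x ∈ parabolaHypograph :=
  le_refl (x ^ 2)

theorem parabolaHypograph_mem_DCDistSets : parabolaHypograph ∈ DCDistSets 2 := by
  have hU : Convex ℝ parabolaHypographᶜ := by
    intro z hz w hw a b ha hb hab
    have hz' : z 0 ^ 2 < z 1 := not_le.1 hz
    have hw' : w 0 ^ 2 < w 1 := not_le.1 hw
    simp only [parabolaHypograph, mem_compl_iff, mem_ofPred_eq, not_le, PiLp.add_apply,
      PiLp.smul_apply, smul_eq_mul]
    have h1 : (a * z 0 + b * w 0) ^ 2 ≤ a * z 0 ^ 2 + b * w 0 ^ 2 := by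
      simpa using (even_two.convexOn_pow : ConvexOn ℝ univ fun t : ℝ => t ^ 2).2
        (mem_univ (z 0)) (mem_univ (w 0)) ha hb hab
    have h2 := mul_le_mul_of_nonneg_left hz'.le ha
    have h3 := mul_le_mul_of_nonneg_left hw'.le hb
    rcases ha.eq_or_lt with rfl | ha'
    · obtain rfl : b = 1 := by linarith
      linarith
    · have := mul_lt_mul_of_pos_left hz' ha'
      linarith
  refine Or.inr ⟨⟨0, by simp [parabolaHypograph]⟩, ?_, ?_⟩
  · exact isClosed_le (by fun_prop) (by fun_prop)
  · have := hU.isDCOn_infDist_compl ⟨!₂[0, 1], by simp [parabolaHypograph]⟩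
      ⟨0, by simp [parabolaHypograph]⟩
    rwa [compl_compl] at this

/-- The points on or above the secants of the parabola through the points over `x (2 * n)` and
`x (2 * n + 1)`. -/
def aboveSecants (x : ℕ → ℝ) : Set (EuclideanSpace ℝ (Fin 2)) :=
  {z | ∀ n, (x (2 * n) + x (2 * n + 1)) * z 0 - x (2 * n) * x (2 * n + 1) ≤ z 1}

/-- The parabola minus its secant through the points over `p` and `q` is `(t - p) * (t - q)`. -/
theorem mem_aboveSecants_parabolaPoint {x : ℕ → ℝ} {t : ℝ} :
    parabolaPoint t ∈ aboveSecants x ↔ ∀ n, 0 ≤ (t - x (2 * n)) * (t - x (2 * n + 1)) := by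
  refine forall_congr' fun n => ?_
  simp only [parabolaPoint_zero, parabolaPoint_one]
  rw [← sub_nonneg]
  ring_nf

theorem parabolaPoint_mem_aboveSecants {x : ℕ → ℝ} (hx : Antitone x) (k : ℕ) :
    parabolaPoint (x k) ∈ aboveSecants x := by
  rw [mem_aboveSecants_parabolaPoint]
  intro n
  rcases le_or_gt k (2 * n) with h | h
  · exact mul_nonneg (sub_nonneg.2 (hx h)) (sub_nonneg.2 (hx (by omega)))
  · exact mul_nonneg_of_nonpos_of_nonpos (sub_nonpos.2 (hx h.le)) (sub_nonpos.2 (hx h))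

theorem aboveSecants_mem_DCDistSets {x : ℕ → ℝ} (hx : Antitone x) :
    aboveSecants x ∈ DCDistSets 2 := by
  have hne : (aboveSecants x).Nonempty := ⟨_, parabolaPoint_mem_aboveSecants hx 0⟩
  have hc : Convex ℝ (aboveSecants x) := by
    intro z hz w hw a b ha hb hab n
    have h1 := mul_le_mul_of_nonneg_left (hz n) ha
    have h2 := mul_le_mul_of_nonneg_left (hw n) hb
    simp only [PiLp.add_apply, PiLp.smul_apply, smul_eq_mul]
    linear_combination h1 + h2 + x (2 * n) * x (2 * n + 1) * hab
  refine Or.inr ⟨hne, ?_, _, 0, hc.convexOn_univ_infDist hne, convexOn_const 0 convex_univ,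
    fun z _ => (sub_zero _).symm⟩
  simp only [aboveSecants, ofPred_forall]
  exact isClosed_iInter fun n => isClosed_le (by fun_prop) (by fun_prop)

theorem union_mem_DCDistSets {d : ℕ} {A B : Set (EuclideanSpace ℝ (Fin d))}
    (hA : A ∈ DCDistSets d) (hB : B ∈ DCDistSets d) : A ∪ B ∈ DCDistSets d := by
  rcases hA with rfl | ⟨hA, hA', dA⟩
  · simpa using hB
  rcases hB with rfl | ⟨hB, hB', dB⟩
  · rw [union_empty]
    exact Or.inr ⟨hA, hA', dA⟩
  refine Or.inr ⟨hA.inl, hA'.union hB', ?_⟩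
  simpa only [infDist_union_eq_min hA hB] using dA.min dB

theorem inter_aboveSecants_not_mem_DCDistSets {x : ℕ → ℝ} (hx : StrictAnti x) (hpos : ∀ n, 0 < x n)
    (hx0 : Tendsto x atTop (𝓝 0)) : parabolaHypograph ∩ aboveSecants x ∉ DCDistSets 2 := by
  have hmem : ∀ k, parabolaPoint (x k) ∈ parabolaHypograph ∩ aboveSecants x := fun k =>
    ⟨parabolaPoint_mem_parabolaHypograph _, parabolaPoint_mem_aboveSecants hx.antitone k⟩
  refine not_mem_DCDistSets_of_strips (a := fun k => x (2 * k + 1)) (b := fun k => x (2 * k))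
    (fun k => hpos _) (fun k => hx (by omega)) (fun k => hx.antitone (by omega))
    (hx0.comp (tendsto_id.const_mul_atTop' two_pos)) (fun k => hmem _) (fun k => hmem _) ?_
  rintro k z ⟨hz, hz'⟩ ⟨h1, h2⟩
  have h3 := hz' k
  have h4 : z 1 ≤ z 0 ^ 2 := hz
  nlinarith [mul_pos (sub_pos.2 h1) (sub_pos.2 h2)]

theorem parabolaPoint_mem_closure_compl {x : ℕ → ℝ} (hx : StrictAnti x) (n : ℕ) {t : ℝ}
    (ht : t = x (2 * n) ∨ t = x (2 * n + 1)) :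
    parabolaPoint t ∈ closure (parabolaHypograph ∪ aboveSecants x)ᶜ := by
  have hlt : x (2 * n + 1) < x (2 * n) := hx (by omega)
  -- `γ` runs halfway between parabola and secant, hence outside both sets, and meets the parabola
  -- at the ends.
  let γ : ℝ → EuclideanSpace ℝ (Fin 2) := fun s =>
    !₂[s, (s ^ 2 + ((x (2 * n) + x (2 * n + 1)) * s - x (2 * n) * x (2 * n + 1))) / 2]
  have hγ : Continuous γ := by
    simp only [γ]
    fun_prop
  have hmaps : MapsTo γ (Ioo (x (2 * n + 1)) (x (2 * n))) (parabolaHypograph ∪ aboveSecants x)ᶜ := by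
    rintro s ⟨h1, h2⟩ (h | h)
    · have h3 : (s ^ 2 + ((x (2 * n) + x (2 * n + 1)) * s - x (2 * n) * x (2 * n + 1))) / 2 ≤ s ^ 2 :=
        h
      nlinarith [mul_pos (sub_pos.2 h1) (sub_pos.2 h2)]
    · have h3 : (x (2 * n) + x (2 * n + 1)) * s - x (2 * n) * x (2 * n + 1) ≤
          (s ^ 2 + ((x (2 * n) + x (2 * n + 1)) * s - x (2 * n) * x (2 * n + 1))) / 2 := h n
      nlinarith [mul_pos (sub_pos.2 h1) (sub_pos.2 h2)]
  have htm : t ∈ closure (Ioo (x (2 * n + 1)) (x (2 * n))) := by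
    rw [closure_Ioo hlt.ne]
    rcases ht with rfl | rfl
    · exact right_mem_Icc.2 hlt.le
    · exact left_mem_Icc.2 hlt.le
  have hγt : γ t = parabolaPoint t := by
    have : (t ^ 2 + ((x (2 * n) + x (2 * n + 1)) * t - x (2 * n) * x (2 * n + 1))) / 2 = t ^ 2 := by
      rcases ht with rfl | rfl <;> ring
    simp only [γ, this, parabolaPoint]
  exact hγt ▸ map_mem_closure hγ htm hmaps

theorem not_mem_Ioo_of_mem_closure_compl {x : ℕ → ℝ} (hx : StrictAnti x) (k : ℕ)
    {z : EuclideanSpace ℝ (Fin 2)} (hz : z ∈ closure (parabolaHypograph ∪ aboveSecants x)ᶜ) :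
    z 0 ∉ Ioo (x (2 * k + 2)) (x (2 * k + 1)) := by
  have hopen : IsOpen {z : EuclideanSpace ℝ (Fin 2) | z 0 ∈ Ioo (x (2 * k + 2)) (x (2 * k + 1))} :=
    isOpen_Ioo.preimage (by fun_prop)
  intro hz0
  obtain ⟨w, ⟨hw1, hw2⟩, hw⟩ := mem_closure_iff.1 hz _ hopen hz0
  refine hw ?_
  by_cases h : w ∈ parabolaHypograph
  · exact Or.inl h
  · refine Or.inr fun n => ?_
    have h1 : w 0 ^ 2 < w 1 := not_le.1 h
    -- Over these intervals the parabola lies on or above every secant, so whatever is above the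
    -- parabola is in `aboveSecants x`.
    have h2 : 0 ≤ (w 0 - x (2 * n)) * (w 0 - x (2 * n + 1)) := by
      rcases le_or_gt n k with h | h
      · exact mul_nonneg_of_nonpos_of_nonpos
          (sub_nonpos.2 (hw2.le.trans (hx.antitone (by omega))))
          (sub_nonpos.2 (hw2.le.trans (hx.antitone (by omega))))
      · exact mul_nonneg (sub_nonneg.2 ((hx.antitone (by omega)).trans hw1.le))
          (sub_nonneg.2 ((hx.antitone (by omega)).trans hw1.le))
    nlinarith

theorem not_mem_DCDistSets_of_subset_closure_compl {x : ℕ → ℝ} (hx : StrictAnti x)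
    (hpos : ∀ n, 0 < x n) (hx0 : Tendsto x atTop (𝓝 0)) {S : Set (EuclideanSpace ℝ (Fin 2))}
    (hS : S ⊆ closure (parabolaHypograph ∪ aboveSecants x)ᶜ) (hxS : ∀ n, parabolaPoint (x n) ∈ S) :
    S ∉ DCDistSets 2 :=
  not_mem_DCDistSets_of_strips (a := fun k => x (2 * k + 2)) (b := fun k => x (2 * k + 1))
    (fun k => hpos _) (fun k => hx (by omega)) (fun k => hx.antitone (by omega))
    (hx0.comp (tendsto_atTop_mono (fun k => by simp only [id]; omega) tendsto_id))
    (fun k => hxS _) (fun k => hxS _)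
    fun k _ hz => not_mem_Ioo_of_mem_closure_compl hx k (hS hz)

end Parabola

theorem mainTheorem8 :
    (∃ A B : Set (EuclideanSpace ℝ (Fin 2)),
      A ∈ DCDistSets 2 ∧ B ∈ DCDistSets 2 ∧ A ∩ B ∉ DCDistSets 2) ∧
    (∃ K : Set (EuclideanSpace ℝ (Fin 2)),
      K ∈ DCDistSets 2 ∧ frontier K ∉ DCDistSets 2 ∧ closure Kᶜ ∉ DCDistSets 2) := by
  obtain ⟨x, hx, hpos, hx0⟩ := exists_seq_strictAnti_tendsto (0 : ℝ)
  have hA := parabolaHypograph_mem_DCDistSets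
  have hB := aboveSecants_mem_DCDistSets hx.antitone
  have hcl : ∀ n, parabolaPoint (x n) ∈ closure (parabolaHypograph ∪ aboveSecants x)ᶜ := fun n => by
    obtain ⟨k, rfl | rfl⟩ := n.even_or_odd'
    · exact parabolaPoint_mem_closure_compl hx k (Or.inl rfl)
    · exact parabolaPoint_mem_closure_compl hx k (Or.inr rfl)
  refine ⟨⟨_, _, hA, hB, inter_aboveSecants_not_mem_DCDistSets hx hpos hx0⟩,
    ⟨_, union_mem_DCDistSets hA hB, ?_, ?_⟩⟩
  · rw [frontier_eq_closure_inter_closure]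
    exact not_mem_DCDistSets_of_subset_closure_compl hx hpos hx0 inter_subset_right
      fun n => ⟨subset_closure (Or.inl (parabolaPoint_mem_parabolaHypograph _)), hcl n⟩
  · exact not_mem_DCDistSets_of_subset_closure_compl hx hpos hx0 subset_rfl hcl
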